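/- Let $p > t \ge 2$ be integers. Let $\mathcal{F}$ be the family of all finite graphs without isolated vertices except the star $K_{1,t}$. For $n\ge p$ let $f(n,K_p\mid\mathcal{F})$ be the smallest positive integer $m$ such that every edge coloring of the complete graph $K_n$ that uses at least $m$ colors contains a copy of $K_p$ in which every color class (the graph formed by all edges of one color in the copy together with their endpoints) is isomorphic to a member of $\mathcal{F}$, i.e. is not isomorphic to $K_{1,t}$. Let $\mathrm{ex}(n,K_r)$ be the maximum number of edges of a graph on $n$ vertices with no subgraph isomorphic to $K_r$. Then, with $p$ and $t$ fixed and $n\to\infty$: (i) If $p \ge 2t+1$, then $f(n,K_p\mid\mathcal{F}) = (1+o(1))\,\mathrm{ex}(n,K_{\lceil p/t\rceil})$. (ii) If $t+1 \le p \le 2t$, then $f(n,K_p\mid\mathcal{F}) = O(n^{2-1/t})$. Moreover, for all $n \ge p \ge t+1$, $$f(n,K_p\mid\mathcal{F}) \ge (p-t-1)(n-p+t+1) + \binom{p-t-1}{2} + 1 .$$ -/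

import Mathlib

open Filter Asymptotics
open scoped Topology

namespace MonoDecomp

/-- A family of graphs: a property of graphs that is invariant under isomorphism. -/
structure GraphFamily where
  /-- `Mem H` says that the graph `H` belongs to the family. -/
  Mem : {V : Type} → SimpleGraph V → Prop
  iso_mem : ∀ {V W : Type} {H : SimpleGraph V} {H' : SimpleGraph W},
    Nonempty (H ≃g H') → Mem H → Mem H'

/-- The star `K_{1,t}`: the vertex `0` is joined to the `t` other vertices. -/
abbrev star (t : ℕ) : SimpleGraph (Fin (t + 1)) := SimpleGraph.starGraph 0

/-- The family of all finite graphs without isolated vertices, except (the isomorphic copies of)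
the single graph `F`. -/
def allExcept {U : Type} (F : SimpleGraph U) : GraphFamily where
  Mem {V} H := Finite V ∧ (∀ v, ∃ w, H.Adj v w) ∧ ¬ Nonempty (H ≃g F)
  iso_mem := by
    rintro V W H H' ⟨e⟩ ⟨hfin, hiso, hF⟩
    refine ⟨Finite.of_equiv V e.toEquiv, fun w => ?_, fun ⟨e'⟩ => hF ⟨e.trans e'⟩⟩
    obtain ⟨v, hv⟩ := hiso (e.symm w)
    exact ⟨e v, by simpa using e.map_adj_iff.2 hv⟩

/-- The graph that the color `c` induces under the edge coloring `C` of `G`: its edges are the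
edges of color `c`, its vertices are the ends of these edges. -/
def colorClass {V : Type} {G : SimpleGraph V} (C : G.EdgeLabeling ℕ) (c : ℕ) :
    SimpleGraph (C.labelGraph c).support :=
  (C.labelGraph c).induce (C.labelGraph c).support

/-- The set of colors used by the edge coloring `C`. -/
def usedColors {V : Type} {G : SimpleGraph V} (C : G.EdgeLabeling ℕ) : Set ℕ :=
  {c | ∃ e : G.edgeSet, C e = c}

/-- The coloring that the edge coloring `C` of `K_n` induces on the copy `φ` of `G`. -/
def onCopy {V : Type} {G : SimpleGraph V} {n : ℕ} (C : SimpleGraph.TopEdgeLabeling (Fin n) ℕ)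
    (φ : SimpleGraph.Copy G (⊤ : SimpleGraph (Fin n))) : G.EdgeLabeling ℕ :=
  SimpleGraph.EdgeLabeling.pullback C φ.toHom

/-- The edge coloring `C` of `K_n` contains a copy of `G` all of whose (nonempty) color classes
are members of the family `F`. -/
def HasGoodCopy {V : Type} (G : SimpleGraph V) (F : GraphFamily) {n : ℕ}
    (C : SimpleGraph.TopEdgeLabeling (Fin n) ℕ) : Prop :=
  ∃ φ : SimpleGraph.Copy G (⊤ : SimpleGraph (Fin n)),
    ∀ c ∈ usedColors (onCopy C φ), F.Mem (colorClass (onCopy C φ) c)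

/-- Every edge coloring of `K_n` using at least `m` colors contains a copy of `G` all of whose
color classes are members of `F`. -/
def Forces (n m : ℕ) {V : Type} (G : SimpleGraph V) (F : GraphFamily) : Prop :=
  ∀ C : SimpleGraph.TopEdgeLabeling (Fin n) ℕ, m ≤ (usedColors C).ncard → HasGoodCopy G F C

/-- `f(n, G | F)`: the smallest positive integer `m` such that every edge coloring of `K_n` using
at least `m` colors contains a copy of `G` all of whose color classes are members of `F`. -/
noncomputable def f (n : ℕ) {V : Type} (G : SimpleGraph V) (F : GraphFamily) : ℕ :=
  sInf {m : ℕ | 1 ≤ m ∧ Forces n m G F}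

/-- The minimum in the definition of `f` is attained. -/
theorem f_isLeast (n : ℕ) {V : Type} (G : SimpleGraph V) (F : GraphFamily) :
    IsLeast {m : ℕ | 1 ≤ m ∧ Forces n m G F} (f n G F) := by
  have hne : {m : ℕ | 1 ≤ m ∧ Forces n m G F}.Nonempty := by
    refine ⟨Nat.card (⊤ : SimpleGraph (Fin n)).edgeSet + 1, by omega, fun C hC => ?_⟩
    have h : (usedColors C).ncard ≤ Nat.card (⊤ : SimpleGraph (Fin n)).edgeSet := by
      have hC' : usedColors C = (fun e => C e) '' Set.univ := by
        ext c
        simp [usedColors]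
      rw [hC', ← Set.ncard_univ]
      exact Set.ncard_image_le Set.finite_univ
    omega
  exact ⟨Nat.sInf_mem hne, fun _ hm => Nat.sInf_le hm⟩

end MonoDecomp

/-! Lower bounds. Partition the vertices into fibers, give each edge between fibers a private color,
and color an edge inside a fiber by its smaller end. If a copy of `K_p` has more than `t` vertices
in one fiber, the vertex with exactly `t` copy vertices above it in that fiber is the center of a
color class `K_{1,t}`, so the copy is not good. The colors are at least as many as the edges between
fibers. Turán's partition gives (i) from below; `p - t - 1` singletons and one large fiber give the
explicit bound (`card_crossGraph_lt_f`).

Upper bounds. Keep one edge of each color: a rainbow graph `G`. By `hasGoodCopy_of_blocks` it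
suffices to find blocks of `t` vertices, completely joined in `G`, such that no color of a joining
edge recurs inside a block. A monochromatic `K_{1,t}` does not fit into one block, and a joining
edge is alone in its color while `t ≥ 2`.

For (i), Erdős–Stone puts a complete equipartite graph with huge parts into `G`, and a pairwise
independent choice of one block per part avoids the bad colors. For (ii), two blocks suffice: count
pairs of completely joined `t`-tuples as in Kővári–Sós–Turán and show that fewer than all of them
are bad. -/

namespace MonoDecomp

open SimpleGraph Finset

/-! ### Colors of pairs and color classes of a copy -/

/-- The color of the pair `x, y` under an edge coloring of `K_n`, with value `0` on the diagonal. -/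
def col {n : ℕ} (C : TopEdgeLabeling (Fin n) ℕ) (x y : Fin n) : ℕ :=
  if h : x ≠ y then C.get x y h else 0

theorem col_of_ne {n : ℕ} (C : TopEdgeLabeling (Fin n) ℕ) {x y : Fin n} (h : x ≠ y) :
    col C x y = C.get x y h := dif_pos h

theorem col_comm {n : ℕ} (C : TopEdgeLabeling (Fin n) ℕ) (x y : Fin n) :
    col C x y = col C y x := by
  by_cases h : x = y
  · rw [h]
  · rw [col_of_ne C h, col_of_ne C (show y ≠ x from fun e => h e.symm)]
    exact EdgeLabeling.get_comm (C := C) y x h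

theorem labelGraph_onCopy_adj {p n : ℕ} (C : TopEdgeLabeling (Fin n) ℕ)
    (φ : Copy (⊤ : SimpleGraph (Fin p)) (⊤ : SimpleGraph (Fin n))) (c : ℕ) (u v : Fin p) :
    ((onCopy C φ).labelGraph c).Adj u v ↔ u ≠ v ∧ col C (φ u) (φ v) = c := by
  rw [EdgeLabeling.labelGraph_adj]
  constructor
  · rintro ⟨h, hc⟩
    refine ⟨h, ?_⟩
    exact (col_of_ne C (x := φ u) (y := φ v) (fun e => h (φ.injective e))).trans hc
  · rintro ⟨h, hc⟩
    refine ⟨h, ?_⟩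
    exact (col_of_ne C (x := φ u) (y := φ v) (fun e => h (φ.injective e))).symm.trans hc

theorem finite_usedColors {n : ℕ} (C : TopEdgeLabeling (Fin n) ℕ) : (usedColors C).Finite :=
  Set.finite_range (fun e => C e)

/-- A graph that is the image of the star `K_{1,t}` under an injection is, after deleting its
isolated vertices, isomorphic to the star. -/
theorem nonempty_iso_star {V : Type} {t : ℕ} (ht : 1 ≤ t) (H : SimpleGraph V)
    (g : Fin (t + 1) → V) (hg : Function.Injective g)
    (hH : ∀ u v, H.Adj u v ↔ ∃ i j, (star t).Adj i j ∧ g i = u ∧ g j = v) :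
    Nonempty (H.induce H.support ≃g star t) := by
  have hadj : ∀ i j, H.Adj (g i) (g j) ↔ (star t).Adj i j := by
    intro i j
    rw [hH]
    constructor
    · rintro ⟨i', j', h, hi, hj⟩
      rwa [← hg hi, ← hg hj]
    · intro h
      exact ⟨i, j, h, rfl, rfl⟩
  have hnb : ∀ i : Fin (t + 1), ∃ j, (star t).Adj i j := by
    intro i
    by_cases hi : i = 0
    · refine ⟨⟨1, by omega⟩, ?_⟩
      rw [starGraph_adj]
      subst hi
      refine ⟨fun h => ?_, Or.inl rfl⟩
      have := congrArg Fin.val h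
      simp at this
    · exact ⟨0, starGraph_adj.2 ⟨hi, Or.inr rfl⟩⟩
  have hmem : ∀ i, g i ∈ H.support := by
    intro i
    obtain ⟨j, hj⟩ := hnb i
    exact (mem_support H).2 ⟨g j, (hadj i j).2 hj⟩
  let e : Fin (t + 1) → H.support := fun i => ⟨g i, hmem i⟩
  have he : Function.Bijective e := by
    constructor
    · intro i j h
      exact hg (congrArg Subtype.val h)
    · rintro ⟨v, hv⟩
      obtain ⟨w, hw⟩ := (mem_support H).1 hv
      obtain ⟨i, j, -, hi, -⟩ := (hH v w).1 hw
      exact ⟨i, Subtype.ext hi⟩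
  let E : star t ≃g H.induce H.support :=
    { Equiv.ofBijective e he with
      map_rel_iff' := by
        intro i j
        exact hadj i j }
  exact ⟨E.symm⟩

/-! ### Blocks that give a good copy, and rainbow graphs -/

/-- A coloring of `K_n` contains a good copy of `K_p` if it contains `r` disjoint blocks of `t`
vertices such that the edges between distinct blocks have pairwise distinct colors, none of which
occurs inside a block, and `p ≤ r * t`. -/
theorem hasGoodCopy_of_blocks {n p t r : ℕ} (ht : 2 ≤ t) (hp : p ≤ r * t)
    (C : TopEdgeLabeling (Fin n) ℕ) (ψ : Fin r × Fin t → Fin n) (hψ : Function.Injective ψ)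
    (hcross : ∀ u v u' v' : Fin r × Fin t, u.1 ≠ v.1 → u'.1 ≠ v'.1 →
      col C (ψ u) (ψ v) = col C (ψ u') (ψ v') → s(u, v) = s(u', v'))
    (hin : ∀ u v u' v' : Fin r × Fin t, u ≠ v → u.1 = v.1 → u'.1 ≠ v'.1 →
      col C (ψ u) (ψ v) ≠ col C (ψ u') (ψ v')) :
    HasGoodCopy (⊤ : SimpleGraph (Fin p)) (allExcept (star t)) C := by
  let ι : Fin p → Fin r × Fin t := fun i => finProdFinEquiv.symm (Fin.castLE hp i)
  have hι : Function.Injective ι :=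
    finProdFinEquiv.symm.injective.comp (Fin.castLE_injective hp)
  let φ : Copy (⊤ : SimpleGraph (Fin p)) (⊤ : SimpleGraph (Fin n)) :=
    ⟨⟨fun i => ψ (ι i), fun {a b} h e => h (hι (hψ e))⟩, hψ.comp hι⟩
  refine ⟨φ, fun c _ => ⟨inferInstance, ?_, ?_⟩⟩
  · rintro ⟨v, hv⟩
    obtain ⟨w, hw⟩ := (mem_support _).1 hv
    exact ⟨⟨w, (mem_support _).2 ⟨v, hw.symm⟩⟩, hw⟩
  · rintro ⟨e⟩
    let g : Fin (t + 1) → Fin r × Fin t := fun i => ι (e.symm i).1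
    have hg : Function.Injective g :=
      hι.comp (Subtype.val_injective.comp e.symm.injective)
    have hcol : ∀ i : Fin (t + 1), i ≠ 0 → col C (ψ (g 0)) (ψ (g i)) = c := by
      intro i hi
      have h : (star t).Adj 0 i := starGraph_adj.2 ⟨Ne.symm hi, Or.inl rfl⟩
      have h' : (colorClass (onCopy C φ) c).Adj (e.symm 0) (e.symm i) := e.symm.map_adj_iff.2 h
      exact ((labelGraph_onCopy_adj C φ c _ _).1 h').2
    -- A star inside one block would have `t + 1` vertices among `t`. Otherwise some leaf edge joins
    -- two blocks, and a second leaf (`t ≥ 2`) repeats its color.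
    by_cases hall : ∀ i, (g i).1 = (g 0).1
    · have hinj : Function.Injective (fun i => (g i).2) := by
        intro i j hij
        exact hg (Prod.ext ((hall i).trans (hall j).symm) hij)
      have := Fintype.card_le_of_injective _ hinj
      simp at this
    · push Not at hall
      obtain ⟨i, hi⟩ := hall
      have hi0 : i ≠ 0 := by rintro rfl; exact hi rfl
      obtain ⟨j, hj0, hji⟩ : ∃ j : Fin (t + 1), j ≠ 0 ∧ j ≠ i := by
        by_contra! hcon
        have hsub : (univ : Finset (Fin (t + 1))) ⊆ {0, i} := by
          intro j _
          by_cases hj : j = 0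
          · simp [hj]
          · simp [hcon j hj]
        have := (card_le_card hsub).trans card_le_two
        simp at this
        omega
      have hcc := (hcol j hj0).trans (hcol i hi0).symm
      by_cases hj : (g j).1 = (g 0).1
      · exact hin _ _ _ _ (fun h => hj0 (hg h).symm) hj.symm (Ne.symm hi) hcc
      · have := hcross _ _ _ _ (Ne.symm hj) (Ne.symm hi) hcc
        rw [Sym2.eq_iff] at this
        rcases this with ⟨-, h⟩ | ⟨h, -⟩
        · exact hji (hg h)
        · exact hi0 (hg h).symm

/-- A graph whose edges have pairwise distinct colors. -/
def Rainbow {n : ℕ} (C : TopEdgeLabeling (Fin n) ℕ) (G : SimpleGraph (Fin n)) : Prop :=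
  ∀ x y x' y', G.Adj x y → G.Adj x' y' → col C x y = col C x' y' → s(x, y) = s(x', y')

open scoped Classical in
/-- Choosing an edge of each color gives a rainbow graph with as many edges as there are colors. -/
theorem exists_rainbow {n : ℕ} (C : TopEdgeLabeling (Fin n) ℕ) :
    ∃ G : SimpleGraph (Fin n), Rainbow C G ∧ #G.edgeFinset = (usedColors C).ncard := by
  have hrange : usedColors C = Set.range (fun e => C e) := rfl
  obtain ⟨s, hs⟩ : ∃ s : Set (⊤ : SimpleGraph (Fin n)).edgeSet,
      Set.BijOn (fun e => C e) s (usedColors C) := by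
    obtain ⟨s, -, hs⟩ := Set.SurjOn.exists_bijOn_subset
      (f := fun e => C e) (s := Set.univ) (t := usedColors C) (by
        rw [hrange, ← Set.image_univ]; exact Set.surjOn_image _ _)
    exact ⟨s, hs⟩
  let S : Set (Sym2 (Fin n)) := Subtype.val '' s
  have hadj : ∀ x y, (fromEdgeSet S).Adj x y →
      ∃ h : x ≠ y, (⟨s(x, y), h⟩ : (⊤ : SimpleGraph (Fin n)).edgeSet) ∈ s := by
    intro x y h
    rw [fromEdgeSet_adj] at h
    obtain ⟨⟨e, he, hxy⟩, hne⟩ := h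
    refine ⟨hne, ?_⟩
    convert he using 1
    exact Subtype.ext hxy.symm
  refine ⟨fromEdgeSet S, ?_, ?_⟩
  · intro x y x' y' h h' hc
    obtain ⟨hne, hm⟩ := hadj x y h
    obtain ⟨hne', hm'⟩ := hadj x' y' h'
    rw [col_of_ne C hne, col_of_ne C hne'] at hc
    exact congrArg Subtype.val (hs.injOn hm hm' hc)
  · have hE : (fromEdgeSet S).edgeSet = S := by
      rw [edgeSet_fromEdgeSet, sdiff_eq_left, Set.disjoint_left]
      rintro _ ⟨e, -, rfl⟩ hd
      exact not_isDiag_of_mem_edgeSet _ e.2 hd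
    rw [← hs.image_eq, hs.injOn.ncard_image,
      ← Set.ncard_image_of_injective s Subtype.val_injective, ← Set.ncard_coe_finset,
      coe_edgeFinset, hE]

theorem f_le {n m : ℕ} {V : Type} {G : SimpleGraph V} {F : GraphFamily} (hm : 1 ≤ m)
    (h : Forces n m G F) : f n G F ≤ m := (f_isLeast n G F).2 ⟨hm, h⟩

theorem lt_f {n : ℕ} {V : Type} {G : SimpleGraph V} {F : GraphFamily}
    (C : TopEdgeLabeling (Fin n) ℕ) (h : ¬ HasGoodCopy G F C) :
    (usedColors C).ncard < f n G F := by
  by_contra! hle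
  exact h ((f_isLeast n G F).1.2 C hle)

/-! ### Lower bounds from fiber colorings -/

/-- In a finite linear order, a finset with more than `t` elements has an element with exactly
`t` elements above it, and the elements above it can be listed. -/
theorem exists_top_elements {p t : ℕ} (ψ : Fin p → ℕ) (hψ : Function.Injective ψ)
    (A : Finset (Fin p)) (hA : t + 1 ≤ #A) :
    ∃ g : Fin (t + 1) → Fin p, Function.Injective g ∧ (∀ i, g i ∈ A) ∧
      (∀ i, i ≠ 0 → ψ (g 0) < ψ (g i)) ∧ ∀ v ∈ A, ψ (g 0) < ψ v → ∃ i, i ≠ 0 ∧ g i = v := by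
  classical
  let B := A.image ψ
  have hB : #B = #A := card_image_of_injective A hψ
  let e := B.orderEmbOfFin hB
  -- The last `t + 1` positions in the increasing enumeration; `g 0` is the lowest of them.
  have hk : ∀ i : Fin (t + 1), #A - (t + 1) + i.1 < #A := fun i => by omega
  have hmem : ∀ i : Fin (t + 1), ∃ a ∈ A, ψ a = e ⟨#A - (t + 1) + i.1, hk i⟩ := fun i =>
    mem_image.1 (B.orderEmbOfFin_mem hB _)
  choose g hgA hg using hmem
  refine ⟨g, ?_, hgA, ?_, ?_⟩
  · intro i j hij
    have : e ⟨#A - (t + 1) + i.1, hk i⟩ = e ⟨#A - (t + 1) + j.1, hk j⟩ := by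
      rw [← hg, ← hg, hij]
    have := congrArg Fin.val (e.injective this)
    exact Fin.ext (by simpa using this)
  · intro i hi
    rw [hg, hg, e.lt_iff_lt, Fin.mk_lt_mk]
    have : i.1 ≠ 0 := fun h => hi (Fin.ext h)
    rw [Fin.val_zero]
    omega
  · intro v hv hlt
    have hvB : ψ v ∈ Set.range e := by
      rw [range_orderEmbOfFin]
      exact mem_coe.2 (mem_image_of_mem ψ hv)
    obtain ⟨⟨k, hkA⟩, hk'⟩ := hvB
    rw [hg, ← hk', e.lt_iff_lt, Fin.mk_lt_mk] at hlt
    simp only [Fin.val_zero, add_zero] at hlt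
    refine ⟨⟨k - (#A - (t + 1)), by omega⟩, fun h => ?_, hψ ?_⟩
    · have := congrArg Fin.val h
      simp at this
      omega
    · rw [hg, ← hk']
      congr 1
      exact Fin.ext (by simp; omega)

/-- The coloring of `K_n` in which an edge inside a fiber of `w` is colored by its smaller vertex
and the other edges have private colors. -/
def fiberColoring {n : ℕ} (w : Fin n → ℕ) : TopEdgeLabeling (Fin n) ℕ :=
  EdgeLabeling.mk (fun x y _ => if w x = w y then 2 * min x.1 y.1
    else 2 * Nat.pair (min x.1 y.1) (max x.1 y.1) + 1) (by
      intro x y _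
      rw [min_comm, max_comm]
      simp only [eq_comm])

theorem col_fiberColoring {n : ℕ} (w : Fin n → ℕ) {x y : Fin n} (h : x ≠ y) :
    col (fiberColoring w) x y = if w x = w y then 2 * min x.1 y.1
    else 2 * Nat.pair (min x.1 y.1) (max x.1 y.1) + 1 :=
  col_of_ne _ h

/-- The graph whose edges join distinct fibers of `w`. -/
def crossGraph {n : ℕ} (w : Fin n → ℕ) : SimpleGraph (Fin n) where
  Adj x y := w x ≠ w y
  symm := ⟨fun _ _ h => Ne.symm h⟩
  loopless := ⟨fun _ h => h rfl⟩

-- The private colors alone suffice for this bound: `Nat.pair` of the smaller and the larger end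
-- determines the edge.
open scoped Classical in
theorem card_crossGraph_le {n : ℕ} (w : Fin n → ℕ) :
    #(crossGraph w).edgeFinset ≤ (usedColors (fiberColoring w)).ncard := by
  rw [← Set.ncard_coe_finset, coe_edgeFinset]
  have hsub : (crossGraph w).edgeSet ⊆ (⊤ : SimpleGraph (Fin n)).edgeSet :=
    edgeSet_mono le_top
  refine Set.ncard_le_ncard_of_injOn
    (fun e => if h : e ∈ (⊤ : SimpleGraph (Fin n)).edgeSet then fiberColoring w ⟨e, h⟩ else 0)
    ?_ ?_ (finite_usedColors _)
  · intro e he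
    rw [dif_pos (hsub he)]
    exact ⟨_, rfl⟩
  · intro e he e' he' hee
    simp only [dif_pos (hsub he), dif_pos (hsub he')] at hee
    induction e using Sym2.inductionOn with
    | hf x y =>
      induction e' using Sym2.inductionOn with
      | hf x' y' =>
        have hw : w x ≠ w y := he
        have hw' : w x' ≠ w y' := he'
        have h : x ≠ y := fun h => hw (h ▸ rfl)
        have h' : x' ≠ y' := fun h => hw' (h ▸ rfl)
        have hc : col (fiberColoring w) x y = col (fiberColoring w) x' y' := by
          rw [col_of_ne _ h, col_of_ne _ h']
          exact hee
        rw [col_fiberColoring w h, col_fiberColoring w h', if_neg hw, if_neg hw'] at hc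
        have hp : Nat.pair (min x.1 y.1) (max x.1 y.1) =
          Nat.pair (min x'.1 y'.1) (max x'.1 y'.1) := by omega
        rw [Nat.pair_eq_pair] at hp
        rw [Sym2.eq_iff]
        simp only [Fin.ext_iff]
        omega

open scoped Classical in
/-- If every `p`-set of vertices meets some fiber of `w` in more than `t` vertices, then the number
of pairs in distinct fibers is a lower bound for `f`. -/
theorem card_crossGraph_lt_f {n p t : ℕ} (ht : 1 ≤ t) (w : Fin n → ℕ)
    (hw : ∀ ψ : Fin p → Fin n, Function.Injective ψ → ∃ i, t + 1 ≤ #{x | w (ψ x) = i}) :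
    #(crossGraph w).edgeFinset < f n (⊤ : SimpleGraph (Fin p)) (allExcept (star t)) := by
  refine (card_crossGraph_le w).trans_lt (lt_f _ ?_)
  rintro ⟨φ, hφ⟩
  obtain ⟨i, hi⟩ := hw φ φ.injective
  obtain ⟨g, hg, hgA, hlt, htop⟩ := exists_top_elements (fun x => (φ x).1)
    (Fin.val_injective.comp φ.injective) _ hi
  simp only [mem_filter, mem_univ, true_and] at hgA htop
  set c := 2 * (φ (g 0)).1 with hc
  have hne : ∀ {u v : Fin p}, u ≠ v → φ u ≠ φ v := fun h e => h (φ.injective e)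
  have hH : ∀ u v, ((onCopy (fiberColoring w) φ).labelGraph c).Adj u v ↔
      ∃ i j, (star t).Adj i j ∧ g i = u ∧ g j = v := by
    intro u v
    rw [labelGraph_onCopy_adj]
    constructor
    · rintro ⟨huv, h⟩
      rw [col_fiberColoring w (hne huv)] at h
      split_ifs at h with hww
      · have hv : ∀ a b : Fin p, a ≠ b → w (φ a) = w (φ b) → (φ a).1 = (φ (g 0)).1 →
            (φ (g 0)).1 < (φ b).1 → ∃ j, j ≠ 0 ∧ g 0 = a ∧ g j = b := by
          intro a b hab hwab ha hb
          have ha' : g 0 = a := (φ.injective (Fin.ext ha)).symm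
          obtain ⟨j, hj, hj'⟩ := htop b (by rw [← hwab, ← ha', hgA]) hb
          exact ⟨j, hj, ha', hj'⟩
        have hval : (φ u).1 ≠ (φ v).1 := fun e => hne huv (Fin.ext e)
        rcases lt_or_gt_of_ne hval with hl | hl
        · obtain ⟨j, hj, h1, h2⟩ := hv u v huv hww (by omega) (by omega)
          exact ⟨0, j, starGraph_adj.2 ⟨hj.symm, Or.inl rfl⟩, h1, h2⟩
        · obtain ⟨j, hj, h1, h2⟩ := hv v u huv.symm hww.symm (by omega) (by omega)
          exact ⟨j, 0, starGraph_adj.2 ⟨hj, Or.inr rfl⟩, h2, h1⟩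
      -- Private colors are odd, while `c` is even.
      · omega
    · rintro ⟨i', j', hij, rfl, rfl⟩
      obtain ⟨hij', h0⟩ := starGraph_adj.1 hij
      have hgne : g i' ≠ g j' := fun e => hij' (hg e)
      refine ⟨hgne, ?_⟩
      rw [col_fiberColoring w (hne hgne), if_pos ((hgA _).trans (hgA _).symm)]
      rcases h0 with rfl | rfl
      · have := hlt j' hij'.symm
        omega
      · have := hlt i' hij'
        omega
  have hused : c ∈ usedColors (onCopy (fiberColoring w) φ) := by
    have h01 : (star t).Adj 0 ⟨1, by omega⟩ :=
      starGraph_adj.2 ⟨fun h => by simpa using congrArg Fin.val h, Or.inl rfl⟩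
    obtain ⟨h, h'⟩ := (EdgeLabeling.labelGraph_adj _ _).1 ((hH _ _).2 ⟨_, _, h01, rfl, rfl⟩)
    exact ⟨_, h'⟩
  exact (hφ c hused).2.2 (nonempty_iso_star ht _ g hg hH)

/-- The Turán graph gives a lower bound for `f`. -/
theorem extremalNumber_lt_f {n p t r : ℕ} (ht : 1 ≤ t) (hr : 2 ≤ r) (hp : t * (r - 1) < p) :
    extremalNumber n (⊤ : SimpleGraph (Fin r)) <
      f n (⊤ : SimpleGraph (Fin p)) (allExcept (star t)) := by
  classical
  have : Nontrivial (Fin r) := Fin.nontrivial_iff_two_le.2 hr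
  rw [extremalNumber_top]
  refine lt_of_eq_of_lt ?_ (card_crossGraph_lt_f (p := p) ht (fun x : Fin n => x.1 % (r - 1)) ?_)
  · have : turanGraph n (Fintype.card (Fin r) - 1) =
        crossGraph (fun x : Fin n => x.1 % (r - 1)) := by
      ext x y
      rw [turanGraph_adj, Fintype.card_fin]
      rfl
    congr!
  · intro ψ _
    obtain ⟨i, -, hi⟩ := exists_lt_card_fiber_of_mul_lt_card_of_maps_to
      (s := (univ : Finset (Fin p))) (t := range (r - 1)) (n := t)
      (f := fun x => (ψ x).1 % (r - 1))
      (fun x _ => mem_range.2 (Nat.mod_lt _ (by omega)))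
      (by simpa [mul_comm] using hp)
    exact ⟨i, hi⟩

/-- Joining `p - t - 1` vertices to everything gives a lower bound for `f`. -/
theorem join_lt_f {n p t : ℕ} (ht : 1 ≤ t) (hpt : t < p) (hpn : p ≤ n) :
    (p - t - 1) * (n - p + t + 1) + (p - t - 1).choose 2 <
      f n (⊤ : SimpleGraph (Fin p)) (allExcept (star t)) := by
  classical
  obtain ⟨a, rfl⟩ : ∃ a, p = a + t + 1 := ⟨p - t - 1, by omega⟩
  obtain ⟨b, rfl⟩ : ∃ b, n = a + b := ⟨n - a, by omega⟩
  have ha : a + t + 1 - t - 1 = a := by omega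
  have hb : a + b - (a + t + 1) + t + 1 = b := by omega
  rw [ha, hb]
  -- The first `a` vertices are singleton fibers and the other `b` form fiber `0`. A copy has `a + t
  -- + 1` vertices, so at least `t + 1` of them lie in fiber `0`.
  let w : Fin (a + b) → ℕ := fun x => if x.1 < a then x.1 + 1 else 0
  refine lt_of_eq_of_lt ?_ (card_crossGraph_lt_f (p := a + t + 1) ht w ?_)
  · have hs := sum_degrees_eq_twice_card_edges (crossGraph w)
    rw [Fin.sum_univ_add] at hs
    have h1 : ∀ i : Fin a, (crossGraph w).degree (Fin.castAdd b i) = a + b - 1 := by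
      intro i
      rw [← card_neighborFinset_eq_degree]
      have : (crossGraph w).neighborFinset (Fin.castAdd b i) = univ.erase (Fin.castAdd b i) := by
        ext x
        rw [mem_neighborFinset, mem_erase, Fin.ne_iff_vne]
        simp only [crossGraph, w, Fin.val_castAdd, i.2, if_true, mem_univ, and_true]
        split_ifs <;> omega
      rw [this, card_erase_of_mem (mem_univ _), card_univ, Fintype.card_fin]
    have h2 : ∀ i : Fin b, (crossGraph w).degree (Fin.natAdd a i) = a := by
      intro i
      rw [← card_neighborFinset_eq_degree]
      have : (crossGraph w).neighborFinset (Fin.natAdd a i) =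
          univ.map (Fin.castAddEmb b : Fin a ↪ Fin (a + b)) := by
        ext x
        rw [mem_neighborFinset, Finset.mem_map]
        simp only [crossGraph, w, Fin.val_natAdd, mem_univ, true_and, ne_eq]
        constructor
        · intro h
          have hx : x.1 < a := by
            by_contra hx
            simp [hx] at h
          exact ⟨⟨x.1, hx⟩, Fin.ext rfl⟩
        · rintro ⟨y, rfl⟩
          simp
      rw [this, card_map, card_univ, Fintype.card_fin]
    simp only [h1, h2, sum_const, card_univ, Fintype.card_fin, smul_eq_mul] at hs
    have h3 : a.choose 2 * 2 = a * (a - 1) := by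
      rw [Nat.choose_two_right, Nat.div_mul_cancel (Nat.even_mul_pred_self a).two_dvd]
    generalize #(crossGraph w).edgeFinset = E at hs ⊢
    rcases Nat.eq_zero_or_pos a with h0 | hapos
    · rw [h0] at hs ⊢
      simp only [zero_mul, mul_zero, add_zero] at hs
      rw [zero_mul, Nat.choose_zero_succ]
      omega
    · obtain ⟨k, rfl⟩ : ∃ k, a = k + 1 := ⟨a - 1, by omega⟩
      have e1 : k + 1 + b - 1 = k + b := by omega
      rw [e1] at hs
      simp only [Nat.add_sub_cancel] at h3
      nlinarith
  · intro ψ hψ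
    refine ⟨0, ?_⟩
    have h1 := card_filter_add_card_filter_not (s := (univ : Finset (Fin (a + t + 1))))
      (fun x => w (ψ x) = 0)
    have h2 : #{x | ¬ w (ψ x) = 0} ≤ a := by
      refine le_of_le_of_eq ?_ (card_range a)
      refine card_le_card_of_injOn (fun x => (ψ x).1) ?_
        (Fin.val_injective.comp hψ).injOn
      intro x hx
      simp only [w, coe_filter, mem_univ, true_and, Set.mem_ofPred_eq] at hx
      simp only [coe_range, Set.mem_Iio]
      by_contra hcon
      simp [hcon] at hx
    rw [card_univ, Fintype.card_fin] at h1
    omega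

/-! ### Good blocks in a rainbow equipartite graph -/

/-- Two lines of distinct slopes over `ZMod P` meet in at most one point. -/
theorem card_lines_inter_le_one {P r : ℕ} [Fact P.Prime] (hr : r ≤ P) {i i' : Fin r} (h : i' ≠ i)
    (j j' : ZMod P) :
    #{z : ZMod P × ZMod P | z.1 + (i.1 : ZMod P) * z.2 = j ∧
      z.1 + (i'.1 : ZMod P) * z.2 = j'} ≤ 1 := by
  rw [card_le_one]
  intro z hz z' hz'
  simp only [mem_filter, mem_univ, true_and] at hz hz'
  have hne : ((i'.1 : ZMod P) - (i.1 : ZMod P)) ≠ 0 := by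
    intro h0
    have h1 := sub_eq_zero.1 h0
    rw [ZMod.natCast_eq_natCast_iff'] at h1
    rw [Nat.mod_eq_of_lt (i.2.trans_le hr), Nat.mod_eq_of_lt (i'.2.trans_le hr)] at h1
    exact h (Fin.ext h1)
  have h2 : z.2 = z'.2 := by
    have : ((i'.1 : ZMod P) - (i.1 : ZMod P)) * (z.2 - z'.2) = 0 := by
      linear_combination hz.2 - hz.1 - hz'.2 + hz'.1
    exact sub_eq_zero.1 ((mul_eq_zero.1 this).resolve_left hne)
  refine Prod.ext ?_ h2
  linear_combination hz.1 - hz'.1 - (i.1 : ZMod P) * h2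

/-- A rainbow complete equipartite graph with large parts yields a good copy of `K_p`. -/
theorem exists_hasGoodCopy_of_equipartite (r p t : ℕ) (ht : 2 ≤ t) (hp : p ≤ r * t) :
    ∃ L : ℕ, 1 ≤ L ∧ ∀ (n : ℕ) (C : TopEdgeLabeling (Fin n) ℕ) (G : SimpleGraph (Fin n)), Rainbow C G →
      completeEquipartiteGraph r L ⊑ G →
      HasGoodCopy (⊤ : SimpleGraph (Fin p)) (allExcept (star t)) C := by
  classical
  -- `P > 2rt²` makes the final count work; `P ≥ r` keeps the slopes `0, …, r - 1` distinct mod `P`.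
  obtain ⟨P, hPge, hP⟩ := Nat.exists_infinite_primes (2 * r * t ^ 2 + r + 1)
  have : Fact P.Prime := ⟨hP⟩
  have hrP : r ≤ P := by omega
  refine ⟨P * t, Nat.mul_pos hP.pos (by omega), fun n C G hG ⟨κ⟩ => ?_⟩
  let e : ZMod P ≃ Fin P := Fintype.equivFinOfCardEq (ZMod.card P)
  -- Each part is cut into `P` groups of `t` vertices. A point `z` will select group `z.1 + i * z.2`
  -- in part `i`; this replaces a random choice that is independent for any two parts.
  let θ : Fin r × ZMod P × Fin t → Fin n := fun u => κ (u.1, finProdFinEquiv (e u.2.1, u.2.2))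
  have hθ : Function.Injective θ := by
    rintro ⟨i, j, a⟩ ⟨i', j', a'⟩ h
    have h1 := κ.injective h
    simp only [Prod.mk.injEq, EmbeddingLike.apply_eq_iff_eq] at h1
    obtain ⟨rfl, rfl, rfl⟩ := h1
    rfl
  have hadj : ∀ u v, u.1 ≠ v.1 → G.Adj (θ u) (θ v) := fun u v h =>
    κ.toHom.map_adj (completeEquipartiteGraph_adj.2 h)
  have hrain : ∀ u v u' v' : Fin r × ZMod P × Fin t, u.1 ≠ v.1 → u'.1 ≠ v'.1 →
      col C (θ u) (θ v) = col C (θ u') (θ v') → s(u, v) = s(u', v') := by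
    intro u v u' v' h h' hc
    have := hG _ _ _ _ (hadj u v h) (hadj u' v' h') hc
    rw [Sym2.eq_iff] at this ⊢
    rcases this with ⟨h1, h2⟩ | ⟨h1, h2⟩
    · exact Or.inl ⟨hθ h1, hθ h2⟩
    · exact Or.inr ⟨hθ h1, hθ h2⟩
  -- `S q` holds the `z` that select the group of the pair `q` and also the group of an end `u`, in
  -- another part, of a joining edge with the color of that pair. At most one joining edge has this
  -- color, and each of its two ends leaves at most one `z`.
  let S : Fin r × ZMod P × Fin t × Fin t → Finset (ZMod P × ZMod P) := fun q =>
    {z | z.1 + (q.1.1 : ZMod P) * z.2 = q.2.1 ∧ ∃ u v : Fin r × ZMod P × Fin t, u.1 ≠ v.1 ∧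
      u.1 ≠ q.1 ∧ z.1 + (u.1.1 : ZMod P) * z.2 = u.2.1 ∧
      col C (θ (q.1, q.2.1, q.2.2.1)) (θ (q.1, q.2.1, q.2.2.2)) = col C (θ u) (θ v)}
  have hS : ∀ q, #(S q) ≤ 2 := by
    intro q
    by_cases hq : ∃ u₀ v₀ : Fin r × ZMod P × Fin t, u₀.1 ≠ v₀.1 ∧
      col C (θ (q.1, q.2.1, q.2.2.1)) (θ (q.1, q.2.1, q.2.2.2)) = col C (θ u₀) (θ v₀)
    · obtain ⟨u₀, v₀, h₀, hc₀⟩ := hq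
      let T : Fin r × ZMod P × Fin t → Finset (ZMod P × ZMod P) := fun u =>
        if u.1 ≠ q.1 then univ.filter fun z => z.1 + (q.1.1 : ZMod P) * z.2 = q.2.1 ∧
          z.1 + (u.1.1 : ZMod P) * z.2 = u.2.1 else ∅
      have hT : ∀ u, #(T u) ≤ 1 := by
        intro u
        by_cases hu : u.1 ≠ q.1
        · simp only [T, if_pos hu]
          exact card_lines_inter_le_one hrP hu _ _
        · simp only [T, if_neg hu, card_empty, zero_le]
      have hsub : S q ⊆ T u₀ ∪ T v₀ := by
        intro z hz
        simp only [S, mem_filter, mem_univ, true_and] at hz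
        obtain ⟨hz1, u, v, huv, huq, hzu, hc⟩ := hz
        have hmem : z ∈ T u := by
          simp only [T, if_pos huq, mem_filter, mem_univ, true_and]
          exact ⟨hz1, hzu⟩
        have := hrain _ _ _ _ huv h₀ (hc.symm.trans hc₀)
        rw [Sym2.eq_iff] at this
        rw [mem_union]
        rcases this with ⟨rfl, -⟩ | ⟨rfl, -⟩
        · exact Or.inl hmem
        · exact Or.inr hmem
      calc #(S q) ≤ #(T u₀ ∪ T v₀) := card_le_card hsub
        _ ≤ #(T u₀) + #(T v₀) := card_union_le _ _
        _ ≤ 2 := Nat.add_le_add (hT _) (hT _)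
    · have : S q = ∅ := by
        rw [eq_empty_iff_forall_notMem]
        intro z hz
        simp only [S, mem_filter, mem_univ, true_and] at hz
        obtain ⟨-, u, v, huv, -, -, hc⟩ := hz
        exact hq ⟨u, v, huv, hc⟩
      simp [this]
  -- There are `r * P * t²` indices `q`, hence at most `2rt² * P < P²` bad points.
  obtain ⟨z, hz⟩ : ∃ z, z ∉ univ.biUnion S := by
    by_contra! hall
    have h1 : #(univ : Finset (ZMod P × ZMod P)) ≤ #(univ.biUnion S) :=
      card_le_card fun z _ => hall z
    have h2 := card_biUnion_le_card_mul univ S 2 fun q _ => hS q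
    have h3 := h1.trans h2
    simp only [card_univ, Fintype.card_prod, ZMod.card, Fintype.card_fin] at h3
    have hPpos := hP.pos
    have h4 : P ≤ 2 * r * t ^ 2 := by
      refine Nat.le_of_mul_le_mul_left ?_ hPpos
      calc P * P ≤ r * (P * (t * t)) * 2 := h3
        _ = P * (2 * r * t ^ 2) := by ring
    omega
  have hz' : ∀ q, z ∉ S q := fun q hq => hz (mem_biUnion.2 ⟨q, mem_univ _, hq⟩)
  let η : Fin r × Fin t → Fin r × ZMod P × Fin t := fun u =>
    (u.1, z.1 + (u.1.1 : ZMod P) * z.2, u.2)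
  have hη : Function.Injective η := by
    rintro ⟨i, a⟩ ⟨i', a'⟩ h
    simp only [η, Prod.mk.injEq] at h
    obtain ⟨rfl, -, rfl⟩ := h
    rfl
  refine hasGoodCopy_of_blocks ht hp C (fun u => θ (η u)) (hθ.comp hη) ?_ ?_
  · intro u v u' v' h h' hc
    have := hrain (η u) (η v) (η u') (η v') h h' hc
    rw [Sym2.eq_iff] at this ⊢
    rcases this with ⟨h1, h2⟩ | ⟨h1, h2⟩
    · exact Or.inl ⟨hη h1, hη h2⟩
    · exact Or.inr ⟨hη h1, hη h2⟩
  · rintro ⟨i, a⟩ ⟨i', b⟩ u' v' - hii h' hc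
    obtain rfl : i = i' := hii
    have key : ∀ u v : Fin r × Fin t, u.1 ≠ v.1 → u.1 ≠ i →
        col C (θ (η (i, a))) (θ (η (i, b))) ≠ col C (θ (η u)) (θ (η v)) := by
      intro u v huv hui hcc
      refine hz' (i, z.1 + (i.1 : ZMod P) * z.2, a, b) ?_
      simp only [S, mem_filter, mem_univ, true_and]
      exact ⟨η u, η v, huv, hui, rfl, hcc⟩
    -- A joining edge has an end outside part `i`; take that end as `u` in `key`.
    by_cases hu : u'.1 = i
    · exact key v' u' h'.symm (fun hv => h' (hu.trans hv.symm)) (hc.trans (col_comm C _ _))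
    · exact key u' v' h' hu hc

/-! ### Erdős–Stone and the asymptotics for `p ≥ 2t + 1` -/

/-- In passing from `n` to `n + 1` vertices, the extremal number grows by at most the minimum
degree of an extremal graph. -/
theorem exists_extremalNumber_succ_le {W : Type} (H : SimpleGraph W) (hH : H ≠ ⊥) (n : ℕ) :
    ∃ (G : SimpleGraph (Fin (n + 1))) (_ : DecidableRel G.Adj), H.Free G ∧
      extremalNumber (n + 1) H ≤ extremalNumber n H + G.minDegree := by
  classical
  -- Delete a vertex of minimum degree from an extremal graph.
  obtain ⟨G, hdec, hG⟩ := exists_isExtremal_free (V := Fin (n + 1)) hH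
  refine ⟨G, hdec, hG.prop, ?_⟩
  obtain ⟨v, hv⟩ := G.exists_minimal_degree_vertex
  have h1 := card_edgeFinset_of_isExtremal_free hG
  have h2 := card_edgeFinset_deleteIncidenceSet_le_extremalNumber hG.prop v
  have h3 := card_edgeFinset_deleteIncidenceSet G v
  rw [Fintype.card_fin] at h1 h2
  rw [Nat.add_sub_cancel] at h2
  rw [hv]
  omega

/-- The **Erdős–Stone theorem** for extremal numbers, with an additive constant. -/
theorem exists_extremalNumber_equipartite_le {ε : ℝ} (hε : 0 < ε) (q L : ℕ) (hq : 1 ≤ q)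
    (hL : 1 ≤ L) : ∃ K : ℝ, ∀ n : ℕ,
      (extremalNumber n (completeEquipartiteGraph (q + 1) L) : ℝ) ≤
        K + (1 - 1 / q + ε) * (n * (n + 1) / 2) := by
  obtain ⟨N, hN⟩ := eventually_atTop.1
    (eventually_completeEquipartiteGraph_isContained_of_minDegree hε q L)
  set H := completeEquipartiteGraph (q + 1) L with hHdef
  have hH : H ≠ ⊥ := by
    rw [hHdef, Ne, completeEquipartiteGraph_eq_bot_iff]
    omega
  have hδ : (0 : ℝ) ≤ 1 - 1 / q + ε := by
    have : (1 : ℝ) / q ≤ 1 := by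
      rw [div_le_one (by positivity)]
      exact_mod_cast hq
    linarith
  have hstep : ∀ n, N ≤ n → (extremalNumber (n + 1) H : ℝ) ≤
      extremalNumber n H + (1 - 1 / q + ε) * (n + 1) := by
    intro n hn
    obtain ⟨G, hdec, hfree, hle⟩ := exists_extremalNumber_succ_le H hH n
    have hlt : (G.minDegree : ℝ) < (1 - 1 / q + ε) * ((n + 1 : ℕ) : ℝ) := by
      by_contra! hcon
      exact hfree (hN (n + 1) (by omega) hcon)
    have hle' : (extremalNumber (n + 1) H : ℝ) ≤ extremalNumber n H + G.minDegree := by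
      exact_mod_cast hle
    push_cast at hlt
    linarith
  -- This constant covers every `n ≤ N`; beyond `N` the increments in `hstep` telescope.
  refine ⟨∑ m ∈ range (N + 1), (extremalNumber m H : ℝ), fun n => ?_⟩
  rcases le_total n N with hn | hn
  · have h1 : (extremalNumber n H : ℝ) ≤ ∑ m ∈ range (N + 1), (extremalNumber m H : ℝ) :=
      single_le_sum (f := fun m => (extremalNumber m H : ℝ)) (fun _ _ => Nat.cast_nonneg _)
        (mem_range.2 (by omega))
    have : 0 ≤ (1 - 1 / q + ε) * ((n : ℝ) * (n + 1) / 2) := by positivity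
    linarith
  · induction n, hn using Nat.le_induction with
    | base =>
      have h1 : (extremalNumber N H : ℝ) ≤ ∑ m ∈ range (N + 1), (extremalNumber m H : ℝ) :=
        single_le_sum (f := fun m => (extremalNumber m H : ℝ)) (fun _ _ => Nat.cast_nonneg _)
          (mem_range.2 (by omega))
      have : 0 ≤ (1 - 1 / q + ε) * ((N : ℝ) * (N + 1) / 2) := by positivity
      linarith
    | succ n hn ih =>
      have := hstep n hn
      push_cast
      nlinarith

/-- A lower bound for the number of edges of the Turán graph. -/
theorem le_extremalNumber_top (n q : ℕ) (hq : 1 ≤ q) :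
    (1 - 1 / q : ℝ) * (n ^ 2 / 2) - q ^ 2 - 1 ≤
      extremalNumber n (⊤ : SimpleGraph (Fin (q + 1))) := by
  have : Nontrivial (Fin (q + 1)) := Fin.nontrivial_iff_two_le.2 (by omega)
  rw [extremalNumber_top, Fintype.card_fin, Nat.add_sub_cancel, card_edgeFinset_turanGraph]
  set A := (n ^ 2 - (n % q) ^ 2) * (q - 1) with hA
  have hmod : n % q < q := Nat.mod_lt _ (by omega)
  have hmn : n % q ≤ n := Nat.mod_le _ _
  have h1 : (A : ℝ) < (A / (2 * q) + 1 : ℕ) * (2 * q) := by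
    exact_mod_cast Nat.lt_mul_of_div_lt (Nat.lt_succ_self _) (by omega)
  have hA' : (A : ℝ) = (n ^ 2 - (n % q : ℕ) ^ 2) * (q - 1) := by
    rw [hA, Nat.cast_mul, Nat.cast_sub (Nat.pow_le_pow_left hmn 2), Nat.cast_sub hq]
    push_cast
    ring
  have hqpos : (0 : ℝ) < q := by exact_mod_cast hq
  have hq1 : (1 : ℝ) ≤ q := by exact_mod_cast hq
  have hm : ((n % q : ℕ) : ℝ) ^ 2 ≤ q ^ 2 := by
    exact_mod_cast Nat.pow_le_pow_left hmod.le 2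
  push_cast at h1 ⊢
  have h2 : (0 : ℝ) ≤ ((n % q).choose 2 : ℕ) := Nat.cast_nonneg _
  have h3 : (1 - 1 / q : ℝ) * (n ^ 2 / 2) - q ^ 2 - 1 ≤ ((A / (2 * q) : ℕ) : ℝ) := by
    have h4 : (A : ℝ) / (2 * q) ≤ ((A / (2 * q) : ℕ) : ℝ) + 1 := by
      rw [div_le_iff₀ (by positivity)]
      linarith
    have h5 : (1 - 1 / q : ℝ) * (n ^ 2 / 2) - q ^ 2 ≤ (A : ℝ) / (2 * q) := by
      rw [le_div_iff₀ (by positivity), hA']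
      have : ((1 - 1 / q : ℝ) * (n ^ 2 / 2) - q ^ 2) * (2 * q) =
          n ^ 2 * (q - 1) - 2 * q ^ 3 := by
        field_simp
      rw [this]
      have : ((n % q : ℕ) : ℝ) ^ 2 * (q - 1) ≤ q ^ 2 * (q - 1) :=
        mul_le_mul_of_nonneg_right hm (by linarith)
      nlinarith [pow_pos hqpos 3, pow_pos hqpos 2]
    linarith
  linarith

/-- `f` is asymptotically equal to the Turán number. -/
theorem isEquivalent_f {p t q : ℕ} (ht : 2 ≤ t) (hq : 2 ≤ q) (hlo : t * q < p)
    (hhi : p ≤ (q + 1) * t) :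
    (fun n : ℕ => (f n (⊤ : SimpleGraph (Fin p)) (allExcept (star t)) : ℝ)) ~[atTop]
      (fun n : ℕ => (extremalNumber n (⊤ : SimpleGraph (Fin (q + 1))) : ℝ)) := by
  classical
  obtain ⟨L, hL1, hgood⟩ := exists_hasGoodCopy_of_equipartite (q + 1) p t ht hhi
  have hL : ∀ n, f n (⊤ : SimpleGraph (Fin p)) (allExcept (star t)) ≤
      extremalNumber n (completeEquipartiteGraph (q + 1) L) + 1 := by
    intro n
    refine f_le (by omega) fun C hC => ?_
    obtain ⟨G, hG, hcard⟩ := exists_rainbow C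
    refine hgood n C G hG (IsContained.of_extremalNumber_lt_card_edgeFinset ?_)
    rw [Fintype.card_fin]
    omega
  rw [IsEquivalent, isLittleO_iff]
  intro ε hε
  -- The quadratic error becomes `ε n² / 16`, well below `ε n² / 4`, which is about the least that
  -- `ε` times the Turán number can be when `q ≥ 2`.
  obtain ⟨K, hK⟩ := exists_extremalNumber_equipartite_le (ε := ε / 8) (by positivity) q L
    (by omega) hL1
  have hqR : (2 : ℝ) ≤ q := by exact_mod_cast hq
  have hq2 : (1 : ℝ) / q ≤ 1 / 2 := one_div_le_one_div_of_le two_pos hqR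
  have hq0 : (0 : ℝ) ≤ 1 / q := by positivity
  set B : ℝ := |K| + 1 + q ^ 2 + 1 with hB
  have hBpos : 0 < B := by positivity
  -- From this size on, the constant and linear error terms together are at most `ε n² / 16`.
  have hev : ∀ᶠ n : ℕ in atTop, 1 + (B * (1 + ε) + 1 + ε) * (16 / ε) < (n : ℝ) :=
    tendsto_natCast_atTop_atTop.eventually_gt_atTop _
  filter_upwards [hev] with n hn
  have hnpos : (0 : ℝ) < n := lt_trans (by positivity) hn
  have hlow : (extremalNumber n (⊤ : SimpleGraph (Fin (q + 1))) : ℝ) ≤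
      f n (⊤ : SimpleGraph (Fin p)) (allExcept (star t)) := by
    exact_mod_cast (extremalNumber_lt_f (n := n) (r := q + 1) (by omega : 1 ≤ t) (by omega)
      (by simpa using hlo)).le
  have hup : (f n (⊤ : SimpleGraph (Fin p)) (allExcept (star t)) : ℝ) ≤
      extremalNumber n (completeEquipartiteGraph (q + 1) L) + 1 := by exact_mod_cast hL n
  have hex := le_extremalNumber_top n q (by omega)
  have hKn := hK n
  rw [Pi.sub_apply, Real.norm_of_nonneg (by linarith), Real.norm_of_nonneg (Nat.cast_nonneg _)]
  have hn1 : (1 : ℝ) ≤ n := by nlinarith [show 0 < (B * (1 + ε) + 1 + ε) * (16 / ε) by positivity]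
  have hbig : (B * (1 + ε) + 1 + ε) * 16 ≤ ε * n := by
    have h1 : (B * (1 + ε) + 1 + ε) * (16 / ε) ≤ n := by linarith
    have h2 : (B * (1 + ε) + 1 + ε) * (16 / ε) * ε ≤ n * ε :=
      mul_le_mul_of_nonneg_right h1 hε.le
    have h3 : (B * (1 + ε) + 1 + ε) * (16 / ε) * ε = (B * (1 + ε) + 1 + ε) * 16 := by
      field_simp
    linarith
  have hKabs := le_abs_self K
  set E : ℝ := (extremalNumber n (⊤ : SimpleGraph (Fin (q + 1))) : ℝ)
  set F : ℝ := (f n (⊤ : SimpleGraph (Fin p)) (allExcept (star t)) : ℝ)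
  have hElow : (n : ℝ) ^ 2 / 4 - B ≤ E := by
    have : (1 / 2 : ℝ) * (n ^ 2 / 2) ≤ (1 - 1 / q) * (n ^ 2 / 2) :=
      mul_le_mul_of_nonneg_right (by linarith) (by positivity)
    have := abs_nonneg K
    linarith
  have hdiff : F - E ≤ B + (1 + ε) * n + ε / 16 * n ^ 2 := by
    have h1 : (1 - 1 / (q : ℝ) + ε / 8) * (n * (n + 1) / 2) =
      (1 - 1 / (q : ℝ)) * (n ^ 2 / 2) + (1 - 1 / (q : ℝ)) * (n / 2) + ε / 16 * n ^ 2
        + ε / 16 * n := by ring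
    have h2 : (1 - 1 / (q : ℝ)) * (n / 2) ≤ 1 * (n / 2) :=
      mul_le_mul_of_nonneg_right (by linarith) (by positivity)
    have h3 : 0 ≤ ε * n := by positivity
    linarith
  have hbig2 : (B * (1 + ε) + 1 + ε) * 16 * n ≤ ε * n * n :=
    mul_le_mul_of_nonneg_right hbig hnpos.le
  have h4 : B * (1 + ε) ≤ B * (1 + ε) * n := le_mul_of_one_le_right (by positivity) hn1
  have h5 : ε * ((n : ℝ) ^ 2 / 4 - B) ≤ ε * E := mul_le_mul_of_nonneg_left hElow hε.le
  have h6 : (0 : ℝ) ≤ (1 + ε) * n := by positivity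
  have h7 : 0 ≤ ε * (n : ℝ) ^ 2 := by positivity
  nlinarith

/-! ### Counting pairs of joined tuples for `p ≤ 2t` -/

/-- The number of tuples over `N` with one coordinate restricted to at most `s` values, which may
depend on the other coordinates. -/
theorem card_filter_coord_le {V : Type} [DecidableEq V] {k : ℕ} (N : Finset V) (m : Fin (k + 1))
    (Y : (Fin k → V) → Finset V) (s : ℕ) (hY : ∀ g, #(Y g) ≤ s) :
    #{T ∈ Fintype.piFinset (fun _ : Fin (k + 1) => N) |
      T m ∈ Y (m.removeNth (α := fun _ => V) T)} ≤
      s * #N ^ k := by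
  have hcard : #(Fintype.piFinset (fun _ : Fin k => N)) = #N ^ k := by
    simp [Fintype.card_piFinset]
  rw [← hcard]
  refine card_le_mul_card_image_of_maps_to (f := fun T => m.removeNth T) ?_ s ?_
  · intro T hT
    rw [mem_filter, Fintype.mem_piFinset] at hT
    rw [Fintype.mem_piFinset]
    exact fun i => hT.1 _
  · intro g _
    refine (card_le_card_of_injOn (fun T => T m) ?_ ?_).trans (hY g)
    · intro T hT
      simp only [coe_filter, Set.mem_ofPred_eq] at hT
      rw [mem_filter] at hT
      rw [← hT.2]
      exact hT.1.2
    · intro T hT T' hT' h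
      simp only [coe_filter, Set.mem_ofPred_eq] at hT hT'
      rw [← Fin.insertNth_self_removeNth m T, ← Fin.insertNth_self_removeNth m T', hT.2, hT'.2]
      have h' : T m = T' m := h
      rw [h']

variable {n t : ℕ}

open scoped Classical in
/-- The common neighbors of the vertices of a tuple. -/
noncomputable def commonNbrs (G : SimpleGraph (Fin n)) (W : Fin t → Fin n) : Finset (Fin n) :=
  {x | ∀ l, G.Adj x (W l)}

theorem mem_commonNbrs {G : SimpleGraph (Fin n)} {W : Fin t → Fin n} {x : Fin n} :
    x ∈ commonNbrs G W ↔ ∀ l, G.Adj x (W l) := by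
  classical
  simp [commonNbrs]

/-- The tuple `T` of common neighbors of `W` is clashing if it has a repeated entry or if some edge
inside `W` has the color of an edge between `W` and `T`. -/
def Clash (C : TopEdgeLabeling (Fin n) ℕ) (W T : Fin t → Fin n) : Prop :=
  (∃ a b, a ≠ b ∧ T a = T b) ∨ ∃ a b l m, col C (W a) (W b) = col C (W l) (T m)

-- Each kind of clash restricts one coordinate of `T`. A repetition, with `t²` choices of positions,
-- fixes one entry by another. A color repeated from inside `W`, with `t³` choices of the pair and
-- the position, leaves two values for an entry, since `G` has at most one edge of that color.
open scoped Classical in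
theorem card_clash_le {C : TopEdgeLabeling (Fin n) ℕ} {G : SimpleGraph (Fin n)}
    (hG : Rainbow C G) (ht : 1 ≤ t) (W : Fin t → Fin n) :
    #{T ∈ Fintype.piFinset (fun _ : Fin t => commonNbrs G W) | Clash C W T} ≤
      (t ^ 2 + 2 * t ^ 3) * #(commonNbrs G W) ^ (t - 1) := by
  obtain ⟨k, rfl⟩ : ∃ k, t = k + 1 := ⟨t - 1, by omega⟩
  rw [Nat.add_sub_cancel]
  set N := commonNbrs G W
  set Ω := Fintype.piFinset (fun _ : Fin (k + 1) => N)
  have h1 : ∀ q : Fin (k + 1) × Fin (k + 1), #{T ∈ Ω | q.1 ≠ q.2 ∧ T q.1 = T q.2} ≤ #N ^ k := by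
    intro q
    by_cases hq : q.1 = q.2
    · simp [hq]
    · obtain ⟨b, hb⟩ := Fin.exists_succAbove_eq (Ne.symm hq)
      have := card_filter_coord_le N q.1 (fun g => {g b}) 1 (fun g => by simp)
      rw [one_mul] at this
      refine le_trans (card_le_card ?_) this
      intro T hT
      rw [mem_filter] at hT ⊢
      refine ⟨hT.1, mem_singleton.2 ?_⟩
      rw [hT.2.2, Fin.removeNth, hb]
  have h2 : ∀ q : Fin (k + 1) × Fin (k + 1) × Fin (k + 1),
      #{T ∈ Ω | ∃ l, col C (W q.1) (W q.2.1) = col C (W l) (T q.2.2)} ≤ 2 * #N ^ k := by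
    intro q
    let Y : Finset (Fin n) := {x ∈ N | ∃ l, col C (W q.1) (W q.2.1) = col C (W l) x}
    have hY : #Y ≤ 2 := by
      rcases Y.eq_empty_or_nonempty with h0 | ⟨x₀, hx₀⟩
      · simp [h0]
      · obtain ⟨hx₀N, l₀, hl₀⟩ := mem_filter.1 hx₀
        -- All the edges in question are the one edge from `W l₀` to `x₀`, so `x` is one of its
        -- ends.
        refine (card_le_card (t := {x₀, W l₀}) ?_).trans card_le_two
        intro x hx
        obtain ⟨hxN, l, hl⟩ := mem_filter.1 hx
        have := hG _ _ _ _ (mem_commonNbrs.1 hxN l).symm (mem_commonNbrs.1 hx₀N l₀).symm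
          (hl.symm.trans hl₀)
        rw [Sym2.eq_iff] at this
        rw [mem_insert, mem_singleton]
        rcases this with ⟨-, h⟩ | ⟨-, h⟩
        · exact Or.inl h
        · exact Or.inr h
    refine le_trans (card_le_card ?_) (card_filter_coord_le N q.2.2 (fun _ => Y) 2 (fun _ => hY))
    intro T hT
    rw [mem_filter] at hT ⊢
    exact ⟨hT.1, mem_filter.2 ⟨Fintype.mem_piFinset.1 hT.1 _, hT.2⟩⟩
  have hsub : {T ∈ Ω | Clash C W T} ⊆
      (univ.biUnion fun q : Fin (k + 1) × Fin (k + 1) => {T ∈ Ω | q.1 ≠ q.2 ∧ T q.1 = T q.2}) ∪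
      (univ.biUnion fun q : Fin (k + 1) × Fin (k + 1) × Fin (k + 1) =>
        {T ∈ Ω | ∃ l, col C (W q.1) (W q.2.1) = col C (W l) (T q.2.2)}) := by
    intro T hT
    rw [mem_filter] at hT
    rw [mem_union, mem_biUnion, mem_biUnion]
    rcases hT.2 with ⟨a, b, hab, h⟩ | ⟨a, b, l, m, h⟩
    · exact Or.inl ⟨(a, b), mem_univ _, mem_filter.2 ⟨hT.1, hab, h⟩⟩
    · exact Or.inr ⟨(a, b, m), mem_univ _, mem_filter.2 ⟨hT.1, l, h⟩⟩
  refine (card_le_card hsub).trans ((card_union_le _ _).trans ?_)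
  refine (Nat.add_le_add (card_biUnion_le_card_mul _ _ _ fun q _ => h1 q)
    (card_biUnion_le_card_mul _ _ _ fun q _ => h2 q)).trans (le_of_eq ?_)
  simp only [card_univ, Fintype.card_prod, Fintype.card_fin]
  ring

/-- Two completely joined tuples that do not clash yield a good copy. -/
theorem hasGoodCopy_of_not_clash {p : ℕ} {C : TopEdgeLabeling (Fin n) ℕ} {G : SimpleGraph (Fin n)}
    (hG : Rainbow C G) (ht : 2 ≤ t) (hp : p ≤ 2 * t) (W T : Fin t → Fin n)
    (hadj : ∀ l m, G.Adj (W l) (T m)) (hWT : ¬ Clash C W T) (hTW : ¬ Clash C T W) :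
    HasGoodCopy (⊤ : SimpleGraph (Fin p)) (allExcept (star t)) C := by
  simp only [Clash, not_or, not_exists, not_and] at hWT hTW
  let ψ : Fin 2 × Fin t → Fin n := fun u => if u.1 = 0 then W u.2 else T u.2
  have hψadj : ∀ u v : Fin 2 × Fin t, u.1 ≠ v.1 → G.Adj (ψ u) (ψ v) := by
    rintro ⟨i, a⟩ ⟨j, b⟩ h
    fin_cases i <;> fin_cases j
    · exact absurd rfl h
    · exact hadj a b
    · exact (hadj b a).symm
    · exact absurd rfl h
  have hψ : Function.Injective ψ := by
    rintro ⟨i, a⟩ ⟨j, b⟩ h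
    by_cases hij : i = j
    · subst hij
      refine Prod.ext rfl ?_
      by_contra hab
      fin_cases i
      · exact hTW.1 a b hab h
      · exact hWT.1 a b hab h
    · exact absurd h (hψadj _ _ hij).ne
  refine hasGoodCopy_of_blocks ht hp C ψ hψ ?_ ?_
  · intro u v u' v' h h' hc
    have := hG _ _ _ _ (hψadj u v h) (hψadj u' v' h') hc
    rw [Sym2.eq_iff] at this ⊢
    rcases this with ⟨h1, h2⟩ | ⟨h1, h2⟩
    · exact Or.inl ⟨hψ h1, hψ h2⟩
    · exact Or.inr ⟨hψ h1, hψ h2⟩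
  · rintro ⟨i, a⟩ ⟨i', b⟩ u v - hii huv hc
    obtain rfl : i = i' := hii
    have key : ∀ l m, col C (ψ (i, a)) (ψ (i, b)) ≠ col C (W l) (T m) := by
      intro l m h
      fin_cases i
      · exact hWT.2 a b l m h
      · exact hTW.2 a b m l (h.trans (col_comm C _ _))
    obtain ⟨j, l⟩ := u
    obtain ⟨j', m⟩ := v
    fin_cases j <;> fin_cases j'
    · exact huv rfl
    · exact key l m hc
    · exact key m l (hc.trans (col_comm C _ _))
    · exact huv rfl

-- Double count the pairs of a vertex and a `t`-tuple of its neighbors.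
open scoped Classical in
theorem sum_card_commonNbrs (G : SimpleGraph (Fin n)) :
    ∑ W : Fin t → Fin n, #(commonNbrs G W) = ∑ x, G.degree x ^ t := by
  have h := sum_card_bipartiteAbove_eq_sum_card_bipartiteBelow
    (s := (univ : Finset (Fin t → Fin n))) (t := (univ : Finset (Fin n)))
    (fun W x => ∀ l, G.Adj x (W l))
  refine Eq.trans ?_ (h.trans (sum_congr rfl fun x _ => ?_))
  · refine sum_congr rfl fun W _ => congrArg card ?_
    ext x
    simp [mem_commonNbrs, bipartiteAbove]
  · have : bipartiteBelow (fun W x => ∀ l, G.Adj x (W l)) (univ : Finset (Fin t → Fin n)) x =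
        Fintype.piFinset fun _ => G.neighborFinset x := by
      ext W
      simp [bipartiteBelow, Fintype.mem_piFinset]
    rw [this]
    simp [Fintype.card_piFinset]

open scoped Classical in
/-- A rainbow graph with many stars `K_{1,t}` yields a good copy of `K_p`. -/
theorem hasGoodCopy_of_lt_sum_degree_pow {p : ℕ} {C : TopEdgeLabeling (Fin n) ℕ}
    {G : SimpleGraph (Fin n)} (hG : Rainbow C G) (ht : 2 ≤ t) (hp : p ≤ 2 * t)
    (h : 2 * (t ^ 2 + 2 * t ^ 3) * n ^ t < ∑ x, G.degree x ^ t) :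
    HasGoodCopy (⊤ : SimpleGraph (Fin p)) (allExcept (star t)) C := by
  set D := t ^ 2 + 2 * t ^ 3 with hD
  let k : (Fin t → Fin n) → ℕ := fun W => #(commonNbrs G W)
  -- Tuples in `A` may repeat entries; `Z` catches repetitions in the second tuple and `Z'` those in
  -- the first.
  let A : Finset ((Fin t → Fin n) × (Fin t → Fin n)) := {q | ∀ l m, G.Adj (q.1 l) (q.2 m)}
  let Z : Finset ((Fin t → Fin n) × (Fin t → Fin n)) := {q ∈ A | Clash C q.1 q.2}
  let Z' : Finset ((Fin t → Fin n) × (Fin t → Fin n)) := {q ∈ A | Clash C q.2 q.1}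
  have hfib : ∀ (P : (Fin t → Fin n) → (Fin t → Fin n) → Prop),
      #{q ∈ A | P q.1 q.2} = ∑ W, #{T ∈ Fintype.piFinset (fun _ : Fin t => commonNbrs G W) |
        P W T} := by
    intro P
    rw [← card_sigma]
    refine card_nbij' (fun q => ⟨q.1, q.2⟩) (fun q => (q.1, q.2)) ?_ ?_ ?_ ?_
    · rintro ⟨W, T⟩ hq
      simp only [A, coe_filter, mem_filter, mem_univ, true_and, Set.mem_ofPred_eq] at hq
      simp only [coe_sigma, Set.mem_sigma_iff, coe_univ, Set.mem_univ, true_and, coe_filter,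
        Set.mem_ofPred_eq, Fintype.mem_piFinset, mem_commonNbrs]
      exact ⟨fun a l => (hq.1 l a).symm, hq.2⟩
    · rintro ⟨W, T⟩ hq
      simp only [coe_sigma, Set.mem_sigma_iff, coe_univ, Set.mem_univ, true_and, coe_filter,
        Set.mem_ofPred_eq, Fintype.mem_piFinset, mem_commonNbrs] at hq
      simp only [A, coe_filter, mem_filter, mem_univ, true_and, Set.mem_ofPred_eq]
      exact ⟨fun a l => (hq.1 l a).symm, hq.2⟩
    · exact fun _ _ => rfl
    · exact fun _ _ => rfl
  have hA : #A = ∑ W, k W ^ t := by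
    have := hfib fun _ _ => True
    simpa [Fintype.card_piFinset, k] using this
  have hZ : #Z ≤ ∑ W, D * k W ^ (t - 1) :=
    (hfib (Clash C)).trans_le (sum_le_sum fun W _ => card_clash_le hG (by omega) W)
  have hZ' : #Z' ≤ #Z := by
    refine card_le_card_of_injOn Prod.swap ?_ Prod.swap_injective.injOn
    rintro ⟨W, T⟩ hq
    simp only [Z', A, coe_filter, mem_filter, mem_univ, true_and, Set.mem_ofPred_eq] at hq
    simp only [Z, A, coe_filter, mem_filter, mem_univ, true_and, Set.mem_ofPred_eq]
    exact ⟨fun l m => (hq.1 m l).symm, hq.2⟩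
  have hk : 2 * D * n ^ t < ∑ W, k W := by
    rw [sum_card_commonNbrs]
    exact h
  have hlt : 2 * ∑ W, D * k W ^ (t - 1) < ∑ W, k W ^ t := by
    obtain ⟨s, rfl⟩ : ∃ s, t = s + 1 := ⟨t - 1, by omega⟩
    rw [Nat.add_sub_cancel]
    -- With `M = 2D` this is `(k^s - M^s)(k - M) ≥ 0`. Summed over the `n^t` tuples `W`, it turns `∑
    -- k > M n^t` into `∑ k^t > M ∑ k^(t-1)`.
    have hpt : ∀ W, (2 * D) ^ s * k W + 2 * (D * k W ^ s) ≤
        k W ^ (s + 1) + (2 * D) ^ s * (2 * D) := by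
      intro W
      rcases le_total (k W) (2 * D) with hle | hle
      · obtain ⟨c, hc⟩ := Nat.exists_eq_add_of_le hle
        have := Nat.pow_le_pow_left hle s
        have h2 := Nat.mul_le_mul_right c this
        calc (2 * D) ^ s * k W + 2 * (D * k W ^ s)
            = (2 * D) ^ s * k W + (2 * D) * k W ^ s := by ring
          _ = (2 * D) ^ s * k W + (k W + c) * k W ^ s := by rw [← hc]
          _ = (2 * D) ^ s * k W + k W ^ (s + 1) + k W ^ s * c := by ring
          _ ≤ (2 * D) ^ s * k W + k W ^ (s + 1) + (2 * D) ^ s * c := by omega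
          _ = k W ^ (s + 1) + (2 * D) ^ s * (k W + c) := by ring
          _ = k W ^ (s + 1) + (2 * D) ^ s * (2 * D) := by rw [← hc]
      · obtain ⟨c, hc⟩ := Nat.exists_eq_add_of_le hle
        have := Nat.pow_le_pow_left hle s
        have h2 := Nat.mul_le_mul_right c this
        calc (2 * D) ^ s * k W + 2 * (D * k W ^ s)
            = (2 * D) ^ s * (2 * D + c) + 2 * (D * k W ^ s) := by rw [← hc]
          _ = (2 * D) ^ s * (2 * D) + (2 * D) ^ s * c + 2 * (D * k W ^ s) := by ring
          _ ≤ (2 * D) ^ s * (2 * D) + k W ^ s * c + 2 * (D * k W ^ s) := by omega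
          _ = k W ^ s * (2 * D + c) + (2 * D) ^ s * (2 * D) := by ring
          _ = k W ^ s * k W + (2 * D) ^ s * (2 * D) := by rw [← hc]
          _ = k W ^ (s + 1) + (2 * D) ^ s * (2 * D) := by ring
    have hsum := sum_le_sum fun W (_ : W ∈ univ) => hpt W
    rw [sum_add_distrib, sum_add_distrib, ← mul_sum, ← mul_sum, sum_const, card_univ,
      Fintype.card_pi_const, Fintype.card_fin, smul_eq_mul] at hsum
    have hpos : 0 < (2 * D) ^ s := by positivity
    have := Nat.mul_lt_mul_of_pos_left hk hpos
    have e : n ^ (s + 1) * ((2 * D) ^ s * (2 * D)) = (2 * D) ^ s * (2 * D * n ^ (s + 1)) := by ring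
    omega
  obtain ⟨q, hqA, hq⟩ : ∃ q ∈ A, q ∉ Z ∪ Z' := by
    by_contra! hall
    have := (card_le_card (s := A) (t := Z ∪ Z') hall).trans (card_union_le _ _)
    omega
  simp only [Z, Z', mem_union, mem_filter, hqA, true_and, not_or] at hq
  exact hasGoodCopy_of_not_clash hG ht hp q.1 q.2 (mem_filter.1 hqA).2 hq.1 hq.2

/-- The power mean inequality bounds `∑ deg^t` below by `(2e)^t / n^(t-1)`, where `e ≥ m` is the
number of edges of the rainbow graph. -/
theorem f_le_of_lt_pow {p m : ℕ} (ht : 2 ≤ t) (hp : p ≤ 2 * t) (hm : 1 ≤ m) (hn : 1 ≤ n)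
    (h : 2 * (t ^ 2 + 2 * t ^ 3) * n ^ (2 * t - 1) < (2 * m) ^ t) :
    f n (⊤ : SimpleGraph (Fin p)) (allExcept (star t)) ≤ m := by
  classical
  refine f_le hm fun C hC => ?_
  obtain ⟨G, hG, hcard⟩ := exists_rainbow C
  refine hasGoodCopy_of_lt_sum_degree_pow hG ht hp ?_
  obtain ⟨s, rfl⟩ : ∃ s, t = s + 1 := ⟨t - 1, by omega⟩
  have hpow : (2 * #G.edgeFinset) ^ (s + 1) ≤ n ^ s * ∑ x, G.degree x ^ (s + 1) := by
    have h1 := pow_sum_div_card_le_sum_pow (s := (univ : Finset (Fin n)))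
      (f := fun x => (G.degree x : ℝ)) (fun _ _ => Nat.cast_nonneg _) s
    rw [card_univ, Fintype.card_fin, div_le_iff₀' (by positivity), ← Nat.cast_sum,
      sum_degrees_eq_twice_card_edges] at h1
    exact_mod_cast h1
  have hle : (2 * m) ^ (s + 1) ≤ (2 * #G.edgeFinset) ^ (s + 1) :=
    Nat.pow_le_pow_left (by omega) _
  refine Nat.lt_of_mul_lt_mul_left (a := n ^ s) ?_
  calc n ^ s * (2 * ((s + 1) ^ 2 + 2 * (s + 1) ^ 3) * n ^ (s + 1))
      = 2 * ((s + 1) ^ 2 + 2 * (s + 1) ^ 3) * n ^ (s + (s + 1)) := by rw [pow_add n s]; ring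
    _ = 2 * ((s + 1) ^ 2 + 2 * (s + 1) ^ 3) * n ^ (2 * (s + 1) - 1) := by congr 2; omega
    _ < (2 * m) ^ (s + 1) := h
    _ ≤ _ := hle.trans hpow

theorem f_isBigO {p : ℕ} (ht : 2 ≤ t) (hp : p ≤ 2 * t) :
    (fun n : ℕ => (f n (⊤ : SimpleGraph (Fin p)) (allExcept (star t)) : ℝ)) =O[atTop]
      (fun n : ℕ => (n : ℝ) ^ (2 - 1 / (t : ℝ))) := by
  set D : ℕ := t ^ 2 + 2 * t ^ 3 with hD
  have hD1 : 1 ≤ 2 * D := by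
    have : 0 < t ^ 2 := by positivity
    omega
  -- The bound obtained is `⌈2DX⌉ + 1 ≤ 2DX + 2`, and `X ≥ 1` absorbs the `2`.
  refine IsBigO.of_bound (2 * D + 2) ?_
  filter_upwards [eventually_ge_atTop 1] with n hn
  set X : ℝ := (n : ℝ) ^ (2 - 1 / (t : ℝ)) with hX
  have hnR : (1 : ℝ) ≤ n := by exact_mod_cast hn
  have htR : (2 : ℝ) ≤ t := by exact_mod_cast ht
  have hX1 : 1 ≤ X := by
    refine Real.one_le_rpow hnR ?_
    have : 1 / (t : ℝ) ≤ 1 := by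
      rw [div_le_one (by positivity)]
      linarith
    linarith
  have hXt : X ^ t = (n : ℝ) ^ (2 * t - 1) := by
    rw [hX, ← Real.rpow_natCast, ← Real.rpow_mul (by positivity), ← Real.rpow_natCast]
    congr 1
    rw [Nat.cast_sub (by omega)]
    push_cast
    field_simp
  have hm : f n (⊤ : SimpleGraph (Fin p)) (allExcept (star t)) ≤ ⌈2 * D * X⌉₊ + 1 := by
    refine f_le_of_lt_pow ht hp (by omega) hn ?_
    rw [← hD, ← @Nat.cast_lt ℝ]
    push_cast
    rw [← hXt]
    have hceil := Nat.le_ceil (2 * D * X)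
    have hDR : (1 : ℝ) ≤ 2 * D := by exact_mod_cast hD1
    calc (2 * D * X ^ t : ℝ) ≤ (2 * D) ^ t * X ^ t :=
          mul_le_mul_of_nonneg_right (le_self_pow₀ hDR (by omega)) (by positivity)
      _ = (2 * D * X) ^ t := (mul_pow _ _ _).symm
      _ < (2 * (⌈2 * D * X⌉₊ + 1)) ^ t := by
          refine pow_lt_pow_left₀ ?_ (by positivity) (by omega)
          linarith [show (0 : ℝ) ≤ 2 * D * X by positivity]
  rw [Real.norm_of_nonneg (Nat.cast_nonneg _), Real.norm_of_nonneg (by positivity)]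
  have h1 : (f n (⊤ : SimpleGraph (Fin p)) (allExcept (star t)) : ℝ) ≤ ⌈2 * D * X⌉₊ + 1 := by
    exact_mod_cast hm
  have h2 := Nat.ceil_lt_add_one (show (0 : ℝ) ≤ 2 * D * X by positivity)
  linarith

end MonoDecomp

/-! ### The theorem -/

theorem theoremt (p t : ℕ) (ht : 2 ≤ t) (hpt : t < p) :
    (2 * t + 1 ≤ p →
      (fun n : ℕ => (MonoDecomp.f n (⊤ : SimpleGraph (Fin p))
        (MonoDecomp.allExcept (MonoDecomp.star t)) : ℝ)) ~[atTop]
      (fun n : ℕ =>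
        (SimpleGraph.extremalNumber n (⊤ : SimpleGraph (Fin ⌈(p : ℚ) / (t : ℚ)⌉₊)) : ℝ))) ∧
    (p ≤ 2 * t →
      (fun n : ℕ => (MonoDecomp.f n (⊤ : SimpleGraph (Fin p))
        (MonoDecomp.allExcept (MonoDecomp.star t)) : ℝ)) =O[atTop]
      (fun n : ℕ => (n : ℝ) ^ (2 - 1 / (t : ℝ)))) ∧
    (∀ n : ℕ, p ≤ n →
      (p - t - 1) * (n - p + t + 1) + (p - t - 1).choose 2 + 1 ≤
        MonoDecomp.f n (⊤ : SimpleGraph (Fin p))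
          (MonoDecomp.allExcept (MonoDecomp.star t))) := by
  have htQ : (0 : ℚ) < t := by exact_mod_cast (by omega : 0 < t)
  refine ⟨fun hp => ?_, fun hp => MonoDecomp.f_isBigO ht hp,
    fun n hn => MonoDecomp.join_lt_f (by omega) hpt hn⟩
  -- This gives `q ≥ 2` below, so the Turán number is of order `n²` and dominates the error terms.
  have h2 : 2 < ⌈(p : ℚ) / (t : ℚ)⌉₊ := by
    rw [Nat.lt_ceil, lt_div_iff₀ htQ]
    exact_mod_cast hp
  obtain ⟨q, hq⟩ : ∃ q, ⌈(p : ℚ) / (t : ℚ)⌉₊ = q + 1 := ⟨⌈(p : ℚ) / (t : ℚ)⌉₊ - 1, by omega⟩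
  have hlo : t * q < p := by
    have : q < ⌈(p : ℚ) / (t : ℚ)⌉₊ := by omega
    rw [Nat.lt_ceil, lt_div_iff₀ htQ, mul_comm] at this
    exact_mod_cast this
  have hhi : p ≤ (q + 1) * t := by
    have := Nat.le_ceil ((p : ℚ) / (t : ℚ))
    rw [hq, div_le_iff₀ htQ] at this
    exact_mod_cast this
  rw [hq]
  exact MonoDecomp.isEquivalent_f ht (by omega) hlo hhi
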